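/- A quasigroup is a set $Q$ with three binary operations $\cdot,\backslash,/$ satisfying, for all $x,y\in Q$, $x\backslash(x\cdot y)=y$, $x\cdot(x\backslash y)=y$, $(x\cdot y)/y=x$ and $(x/y)\cdot y=x$. Write $xy$ for $x\cdot y$, where juxtaposition binds more tightly than $\cdot$. A subquasigroup is a subset closed under the three operations. A quasigroup is medial if $xy\cdot uv=xu\cdot yv$ for all its elements $x,y,u,v$, and trimedial if for all its elements $a,b,c$ (not necessarily distinct) the subquasigroup generated by $\{a,b,c\}$ is medial. Theorem. Let $Q$ be a quasigroup. The following are equivalent: 1. $Q$ is trimedial; 2. $Q$ is right semimedial and a left F-quasigroup, i.e. for all $x,y,z\in Q$, $zy\cdot xx=zx\cdot yx$ and $x\cdot yz=xy\cdot(x\backslash x)z$; 3. $Q$ is left semimedial and a right F-quasigroup, i.e. for all $x,y,z\in Q$, $xx\cdot yz=xy\cdot xz$ and $zy\cdot x=z(x/x)\cdot yx$. -/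

import Mathlib

/-- A quasigroup, as an algebra with three binary operations: the multiplication `x * y`,
the left division `ldiv x y` (the `y` of `x * _ = y`, written `x \ y` on paper) and the right
division `x / y`. The underlying type may be empty. -/
class Quasigroup (Q : Type*) extends Mul Q, Div Q where
  /-- Left division. -/
  ldiv : Q → Q → Q
  ldiv_mul : ∀ x y : Q, ldiv x (x * y) = y
  mul_ldiv : ∀ x y : Q, x * ldiv x y = y
  mul_rdiv : ∀ x y : Q, (x * y) / y = x
  rdiv_mul : ∀ x y : Q, (x / y) * y = x

/-- A subquasigroup: a subset closed under the three operations. -/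
structure Subquasigroup (Q : Type*) [Quasigroup Q] where
  carrier : Set Q
  mul_mem : ∀ {x y : Q}, x ∈ carrier → y ∈ carrier → x * y ∈ carrier
  ldiv_mem : ∀ {x y : Q}, x ∈ carrier → y ∈ carrier → Quasigroup.ldiv x y ∈ carrier
  rdiv_mem : ∀ {x y : Q}, x ∈ carrier → y ∈ carrier → x / y ∈ carrier

namespace Subquasigroup

/-- A subquasigroup is a quasigroup under the restricted operations. -/
instance instQuasigroup {Q : Type*} [Quasigroup Q] (H : Subquasigroup Q) :
    Quasigroup H.carrier where
  mul x y := ⟨x.1 * y.1, H.mul_mem x.2 y.2⟩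
  div x y := ⟨x.1 / y.1, H.rdiv_mem x.2 y.2⟩
  ldiv x y := ⟨Quasigroup.ldiv x.1 y.1, H.ldiv_mem x.2 y.2⟩
  ldiv_mul x y := Subtype.ext (Quasigroup.ldiv_mul x.1 y.1)
  mul_ldiv x y := Subtype.ext (Quasigroup.mul_ldiv x.1 y.1)
  mul_rdiv x y := Subtype.ext (Quasigroup.mul_rdiv x.1 y.1)
  rdiv_mul x y := Subtype.ext (Quasigroup.rdiv_mul x.1 y.1)

/-- The subquasigroup generated by a set `S`: the intersection of all subquasigroups
that contain `S`. -/
def closure {Q : Type*} [Quasigroup Q] (S : Set Q) : Subquasigroup Q where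
  carrier := {x | ∀ H : Subquasigroup Q, S ⊆ H.carrier → x ∈ H.carrier}
  mul_mem hx hy H hH := H.mul_mem (hx H hH) (hy H hH)
  ldiv_mem hx hy H hH := H.ldiv_mem (hx H hH) (hy H hH)
  rdiv_mem hx hy H hH := H.rdiv_mem (hx H hH) (hy H hH)

end Subquasigroup

namespace Quasigroup

/-- The medial law `xy · uv = xu · yv`. -/
def IsMedial (Q : Type*) [Quasigroup Q] : Prop :=
  ∀ x y u v : Q, (x * y) * (u * v) = (x * u) * (y * v)

/-- Every subquasigroup generated by three (not necessarily distinct) elements is medial. -/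
def IsTrimedial (Q : Type*) [Quasigroup Q] : Prop :=
  ∀ a b c : Q, IsMedial (Subquasigroup.closure {a, b, c} : Subquasigroup Q).carrier

/-- The left semimedial law `xx · yz = xy · xz`. -/
def IsLeftSemimedial (Q : Type*) [Quasigroup Q] : Prop :=
  ∀ x y z : Q, (x * x) * (y * z) = (x * y) * (x * z)

/-- The right semimedial law `zy · xx = zx · yx`. -/
def IsRightSemimedial (Q : Type*) [Quasigroup Q] : Prop :=
  ∀ x y z : Q, (z * y) * (x * x) = (z * x) * (y * x)

/-- The left F-law: `x · yz = xy · (x \ x)z`. -/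
def IsLeftF (Q : Type*) [Quasigroup Q] : Prop :=
  ∀ x y z : Q, x * (y * z) = (x * y) * (ldiv x x * z)

/-- The right F-law: `zy · x = z(x / x) · yx`. -/
def IsRightF (Q : Type*) [Quasigroup Q] : Prop :=
  ∀ x y z : Q, (z * y) * x = (z * (x / x)) * (y * x)

end Quasigroup

open Equiv

namespace Quasigroup

variable {Q : Type*} [Quasigroup Q]

/-! Assume right semimedial and left F. The `v` with `xy · uv = xu · yv` are the fixed points of a
word in left translations, `leftDefect x y u`. The left F-law makes this word an autotopism, and
`leftDefect_ldiv_self` makes it an automorphism, so these `v` form a subquasigroup. By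
`rightDefect_eq_leftDefect` the same holds for `x`. Among three generators every instance of the
medial law repeats an entry, hence holds; it then spreads to the closure one slot at a time.
Condition 3 is dual. -/

theorem eq_of_mul_left {x y z : Q} (h : x * y = x * z) : y = z := by
  rw [← ldiv_mul x y, h, ldiv_mul]

theorem eq_of_mul_right {x y z : Q} (h : y * x = z * x) : y = z := by
  rw [← mul_rdiv y x, h, mul_rdiv]

/-- Left translation. -/
def leftMul (x : Q) : Perm Q := ⟨fun y => x * y, ldiv x, ldiv_mul x, mul_ldiv x⟩

/-- Right translation. -/
def rightMul (x : Q) : Perm Q :=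
  ⟨fun y => y * x, fun y => y / x, fun y => mul_rdiv y x, fun y => rdiv_mul y x⟩

@[simp] theorem leftMul_apply (x y : Q) : leftMul x y = x * y := rfl

@[simp] theorem rightMul_apply (x y : Q) : rightMul x y = y * x := rfl

theorem leftMul_inv_apply (x y : Q) : (leftMul x)⁻¹ y = ldiv x y := rfl

theorem rightMul_inv_apply (x y : Q) : (rightMul x)⁻¹ y = y / x := rfl

/-- Three permutations `p`, `q`, `r` with `r (vw) = p v · q w`. -/
def IsAutotopism (p q r : Perm Q) : Prop := ∀ v w : Q, r (v * w) = p v * q w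

namespace IsAutotopism

variable {p q r p' q' r' : Perm Q}

theorem mul (h : IsAutotopism p q r) (h' : IsAutotopism p' q' r') :
    IsAutotopism (p * p') (q * q') (r * r') := fun v w => by
  simp only [Perm.mul_apply]
  rw [h', h]

theorem inv (h : IsAutotopism p q r) : IsAutotopism p⁻¹ q⁻¹ r⁻¹ := fun v w => by
  rw [Perm.inv_eq_iff_eq, h]
  simp

end IsAutotopism

/-- The fixed points of an automorphism. -/
def fixedPoints (p : Perm Q) (h : IsAutotopism p p p) : Subquasigroup Q where
  carrier := {v | p v = v}
  mul_mem {x y} hx hy := by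
    change p (x * y) = x * y
    rw [h, hx, hy]
  ldiv_mem {x y} hx hy := by
    refine eq_of_mul_left (x := x) ?_
    nth_rw 1 [← show p x = x from hx]
    rw [← h, mul_ldiv, hy]
  rdiv_mem {x y} hx hy := by
    refine eq_of_mul_right (x := y) ?_
    nth_rw 2 [← show p y = y from hy]
    rw [← h, rdiv_mul, hx]

/-! ### Defect permutations -/

/-- The instance `xy · uv = xu · yv` of the medial law. -/
def MedialAt (x y u v : Q) : Prop := (x * y) * (u * v) = (x * u) * (y * v)

/-- The permutation `v ↦ v'` with `xy · uv = xu · yv'` in a left semimedial quasigroup. -/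
def leftDefect (x y u : Q) : Perm Q :=
  (leftMul y)⁻¹ * leftMul x * (leftMul u)⁻¹ * leftMul y * (leftMul x)⁻¹ * leftMul u

/-- The permutation `x ↦ x'` with `xy · uv = x'u · yv` in a right semimedial quasigroup. -/
def rightDefect (y u v : Q) : Perm Q :=
  (rightMul u)⁻¹ * rightMul v * (rightMul y)⁻¹ * rightMul u * (rightMul v)⁻¹ * rightMul y

theorem leftDefect_fixes (h : IsLeftSemimedial Q) (x y u v : Q) :
    leftDefect x y u v = v ↔ MedialAt x y u v := by
  have key (s t : Q) : (x * s) * t = (x * x) * (s * ldiv x t) := by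
    rw [h, mul_ldiv]
  rw [MedialAt, key y (u * v), key u (y * v)]
  simp only [leftDefect, Perm.mul_apply, leftMul_apply, leftMul_inv_apply]
  constructor
  · intro e
    have e' := congrArg (fun t => u * ldiv x (y * t)) e
    simp only [mul_ldiv, ldiv_mul] at e'
    rw [e']
  · intro e
    rw [eq_of_mul_left e, ldiv_mul, mul_ldiv, ldiv_mul]

theorem rightDefect_fixes (h : IsRightSemimedial Q) (x y u v : Q) :
    rightDefect y u v x = x ↔ MedialAt x y u v := by
  have key (s t : Q) : t * (s * v) = ((t / v) * s) * (v * v) := by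
    rw [h, rdiv_mul]
  rw [MedialAt, key u (x * y), key y (x * u)]
  simp only [rightDefect, Perm.mul_apply, rightMul_apply, rightMul_inv_apply]
  constructor
  · intro e
    have e' := congrArg (fun t => (t * u) / v * y) e
    simp only [rdiv_mul, mul_rdiv] at e'
    rw [e']
  · intro e
    rw [eq_of_mul_right e, mul_rdiv, rdiv_mul, mul_rdiv]

/-- The two words are cyclic rotations of each other, hence conjugate. -/
theorem leftDefect_cyclic (x y u : Q) :
    leftDefect y u x
      = ((leftMul y)⁻¹ * leftMul x)⁻¹ * leftDefect x y u * ((leftMul y)⁻¹ * leftMul x) := by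
  simp only [leftDefect]
  group

theorem leftDefect_apply_of_cyclic {x y u v : Q} (h : leftDefect y u x v = v) :
    leftDefect x y u (ldiv y (x * v)) = ldiv y (x * v) := by
  rw [leftDefect_cyclic, Perm.mul_apply, Perm.mul_apply, Perm.inv_eq_iff_eq] at h
  exact h

theorem leftDefect_cyclic_apply {x y u v : Q}
    (h : leftDefect x y u (ldiv y (x * v)) = ldiv y (x * v)) : leftDefect y u x v = v := by
  rw [leftDefect_cyclic, Perm.mul_apply, Perm.mul_apply, Perm.inv_eq_iff_eq]
  exact h

/-! ### Left defects are automorphisms -/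

/-- A right semimedial left F-quasigroup is left semimedial. -/
theorem IsRightSemimedial.isLeftSemimedial (hs : IsRightSemimedial Q) (hF : IsLeftF Q) :
    IsLeftSemimedial Q := by
  -- Writing `p = rw` and `q = tw` lets the right semimedial law collect the factors `w` into
  -- squares.
  have key (z w p q : Q) :
      ((z * w) * p) * ((ldiv z z * w) * q) = (z * (w * w)) * (p * q) := by
    obtain ⟨r, rfl⟩ : ∃ r, p = r * w := ⟨_, (rdiv_mul p w).symm⟩
    obtain ⟨t, rfl⟩ : ∃ t, q = t * w := ⟨_, (rdiv_mul q w).symm⟩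
    rw [← hs w r z, ← hs w t, ← hs (w * w), ← hF, hs (w * w), hs w t r]
  intro w p q
  refine eq_of_mul_left (x := w) (Eq.symm ?_)
  rw [hF w (w * p), hF w w p, hF (ldiv w w) w q, key, ← hF (ldiv w w) p q, ← hF]

theorem isAutotopism_leftMul_ldiv (hF : IsLeftF Q) (x : Q) :
    IsAutotopism (leftMul x) (leftMul (ldiv x x)) (leftMul x) := fun v w => hF x v w

theorem isAutotopism_leftMul (h : IsLeftSemimedial Q) (x : Q) :
    IsAutotopism (leftMul x) (leftMul x) (leftMul (x * x)) := fun v w => h x v w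

/-- If `(1, α, β)` is an autotopism, `α` commutes with every `L_u⁻¹ L_v`. -/
theorem IsAutotopism.commute_leftMul {α β : Perm Q} (h : IsAutotopism 1 α β) (u v : Q) :
    Commute α ((leftMul u)⁻¹ * leftMul v) := by
  have key (u : Q) : β * leftMul u = leftMul u * α := by
    ext w
    exact h u w
  have key' : (leftMul u)⁻¹ * β = α * (leftMul u)⁻¹ := by
    rw [inv_mul_eq_iff_eq_mul, ← mul_assoc, ← key, mul_inv_cancel_right]
  rw [Commute, SemiconjBy, ← mul_assoc, ← key', mul_assoc, mul_assoc, key]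

/-- `L_x⁻¹ L_e` with `e = x \ x`. -/
def leftShift (x : Q) : Perm Q := (leftMul x)⁻¹ * leftMul (ldiv x x)

theorem leftMul_ldiv_self (x : Q) : leftMul (ldiv x x) = leftMul x * leftShift x := by
  rw [leftShift, mul_inv_cancel_left]

/-- The semimedial and F autotopisms share the first component `leftMul x`, so it cancels in their
quotient. -/
theorem commute_leftShift (h : IsLeftSemimedial Q) (hF : IsLeftF Q) (x u v : Q) :
    Commute (leftShift x) ((leftMul u)⁻¹ * leftMul v) := by
  refine IsAutotopism.commute_leftMul (β := (leftMul (x * x))⁻¹ * leftMul x) ?_ u v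
  have := (isAutotopism_leftMul h x).inv.mul (isAutotopism_leftMul_ldiv hF x)
  rwa [inv_mul_cancel] at this

/-- A defect is a product of three quotients of left translations. Shifts commute with these and
with each other, so they collect and cancel. -/
theorem leftDefect_ldiv_self (h : IsLeftSemimedial Q) (hF : IsLeftF Q) (x y u : Q) :
    leftDefect (ldiv x x) (ldiv y y) (ldiv u u) = leftDefect x y u := by
  have hc := commute_leftShift h hF
  have comm (a b : Q) : Commute (leftShift a) (leftShift b) := hc a b _
  have split (a b : Q) : (leftMul (ldiv a a))⁻¹ * leftMul (ldiv b b)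
      = ((leftMul a)⁻¹ * leftMul b) * ((leftShift a)⁻¹ * leftShift b) := by
    rw [leftMul_ldiv_self, leftMul_ldiv_self, mul_inv_rev,
      ← mul_assoc _ (leftShift a)⁻¹, ← (hc a a b).inv_left.eq]
    simp only [mul_assoc]
  have hr (a b c d : Q) : Commute ((leftShift a)⁻¹ * leftShift b)
      ((leftMul c)⁻¹ * leftMul d) := (hc a c d).inv_left.mul_left (hc b c d)
  have hd (a b c : Q) : leftDefect a b c = ((leftMul b)⁻¹ * leftMul a)
      * ((leftMul c)⁻¹ * leftMul b) * ((leftMul a)⁻¹ * leftMul c) := by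
    simp only [leftDefect, mul_assoc]
  have cancel : (leftShift y)⁻¹ * leftShift x * ((leftShift u)⁻¹ * leftShift y)
      * ((leftShift x)⁻¹ * leftShift u) = 1 := by
    have e1 : (leftShift y)⁻¹ * leftShift x = leftShift x * (leftShift y)⁻¹ :=
      (comm y x).inv_left.eq
    have e2 : (leftShift u)⁻¹ * leftShift y = leftShift y * (leftShift u)⁻¹ :=
      (comm u y).inv_left.eq
    have e3 : (leftShift x)⁻¹ * leftShift u = leftShift u * (leftShift x)⁻¹ :=
      (comm x u).inv_left.eq
    rw [e1, e2, e3]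
    group
  rw [hd, hd, split, split, split]
  set P := (leftMul y)⁻¹ * leftMul x
  set P' := (leftShift y)⁻¹ * leftShift x
  set S := (leftMul u)⁻¹ * leftMul y
  set S' := (leftShift u)⁻¹ * leftShift y
  set T := (leftMul x)⁻¹ * leftMul u
  set T' := (leftShift x)⁻¹ * leftShift u
  have c1 : P' * S = S * P' := (hr y x u y).eq
  have c2 : P' * S' * T = T * (P' * S') := ((hr y x x u).mul_left (hr u y x u)).eq
  calc P * P' * (S * S') * (T * T') = P * (P' * S) * S' * T * T' := by group
    _ = P * S * (P' * S' * T) * T' := by rw [c1]; group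
    _ = P * S * T * (P' * S' * T') := by rw [c2]; group
    _ = P * S * T := by rw [cancel, mul_one]

theorem isAutotopism_leftDefect (h : IsLeftSemimedial Q) (hF : IsLeftF Q) (x y u : Q) :
    IsAutotopism (leftDefect x y u) (leftDefect x y u) (leftDefect x y u) := by
  have b := isAutotopism_leftMul_ldiv hF
  have := ((((((b y).inv.mul (b x)).mul (b u).inv).mul (b y)).mul (b x).inv).mul (b u))
  change IsAutotopism (leftDefect x y u) (leftDefect (ldiv x x) (ldiv y y) (ldiv u u))
    (leftDefect x y u) at this
  rwa [leftDefect_ldiv_self h hF] at this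

theorem IsRightSemimedial.medialAt_right (hs : IsRightSemimedial Q) (x y u : Q) :
    MedialAt x y u u := hs u y x

theorem IsRightSemimedial.medialAt_outer_right (hs : IsRightSemimedial Q) (x y u : Q) :
    MedialAt x y u y := (hs y u x).symm

/-- The defect fixes `y`, `u` and `y \ xu`, which generate `x`. -/
theorem medialAt_outer (hs : IsRightSemimedial Q) (hF : IsLeftF Q) (x y u : Q) :
    MedialAt x y u x := by
  have h := hs.isLeftSemimedial hF
  let H := fixedPoints (leftDefect x y u) (isAutotopism_leftDefect h hF x y u)
  have hu : u ∈ H.carrier := (leftDefect_fixes h _ _ _ _).2 (hs.medialAt_right _ _ _)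
  have hy : y ∈ H.carrier := (leftDefect_fixes h _ _ _ _).2 (hs.medialAt_outer_right _ _ _)
  have hxu : ldiv y (x * u) ∈ H.carrier := leftDefect_apply_of_cyclic
    ((leftDefect_fixes h _ _ _ _).2 (hs.medialAt_outer_right _ _ _))
  have hx : x ∈ H.carrier := by
    have := H.rdiv_mem (H.mul_mem hy hxu) hu
    rwa [mul_ldiv, mul_rdiv] at this
  exact (leftDefect_fixes h _ _ _ _).1 hx

/-! ### Right defects as left defects -/

/-- The permutation `v ↦ v'` with `va = av'`. -/
def twist (a : Q) : Perm Q := (leftMul a)⁻¹ * rightMul a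

theorem mul_twist_self (a v : Q) : a * twist a v = v * a := mul_ldiv a (v * a)

theorem mul_twist (hs : IsRightSemimedial Q) (hF : IsLeftF Q) (a u v : Q) :
    u * twist a v = v * twist a u := by
  refine eq_of_mul_right (x := a * a) ?_
  rw [hs a, hs a, ← mul_twist_self a u, ← mul_twist_self a v]
  exact medialAt_outer hs hF a (twist a u) (twist a v)

theorem rightMul_twist (hs : IsRightSemimedial Q) (hF : IsLeftF Q) (a v : Q) :
    rightMul (twist a v) = leftMul v * twist a := by
  ext u
  exact mul_twist hs hF a u v

theorem rightDefect_eq_leftDefect (hs : IsRightSemimedial Q) (hF : IsLeftF Q) (y u v : Q) :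
    rightDefect y u v = leftDefect ((twist u)⁻¹ v) u ((twist u)⁻¹ y) := by
  have h := hs.isLeftSemimedial hF
  set κ := twist u
  obtain ⟨y, rfl⟩ := κ.surjective y
  obtain ⟨v, rfl⟩ := κ.surjective v
  rw [show κ⁻¹ (κ v) = v from κ.symm_apply_apply v, show κ⁻¹ (κ y) = y from κ.symm_apply_apply y]
  have hu : rightMul u = leftMul u * κ := by
    simp only [κ, twist, mul_inv_cancel_left]
  set φ := leftDefect v u y with hφ
  have hφu : φ u = u := (leftDefect_fixes h _ _ _ _).2 (hs.medialAt_outer_right _ _ _)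
  -- `κ` is defined from `u` alone, and `φ` is an automorphism fixing `u`.
  have comm : κ * φ = φ * κ := by
    ext w
    refine eq_of_mul_left (x := u) ?_
    simp only [Perm.mul_apply]
    nth_rw 2 [← hφu]
    have auto := isAutotopism_leftDefect h hF v u y
    rw [← hφ] at auto
    rw [← auto, mul_twist_self, mul_twist_self, auto, hφu]
  have e : rightDefect (κ y) u (κ v) = κ⁻¹ * (φ * κ) := by
    rw [rightDefect, rightMul_twist hs hF, rightMul_twist hs hF, hu, hφ, leftDefect]
    simp only [κ]
    group
  rw [e, ← comm, inv_mul_cancel_left]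

theorem isAutotopism_rightDefect (hs : IsRightSemimedial Q) (hF : IsLeftF Q) (y u v : Q) :
    IsAutotopism (rightDefect y u v) (rightDefect y u v) (rightDefect y u v) := by
  rw [rightDefect_eq_leftDefect hs hF]
  exact isAutotopism_leftDefect (hs.isLeftSemimedial hF) hF _ _ _

/-! ### From generators to the closure -/

theorem subset_closure (S : Set Q) : S ⊆ (Subquasigroup.closure S).carrier :=
  fun _ hx _ hH => hH hx

theorem isTrimedial_of_isRightSemimedial (hs : IsRightSemimedial Q) (hF : IsLeftF Q) :
    IsTrimedial Q := by
  intro a b c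
  have h := hs.isLeftSemimedial hF
  set S : Set Q := {a, b, c}
  set H := Subquasigroup.closure S
  have hSH : S ⊆ H.carrier := subset_closure S
  have left (x y u : Q) (hv : ∀ v ∈ S, MedialAt x y u v) : ∀ v ∈ H.carrier, MedialAt x y u v :=
    fun v hv' => (leftDefect_fixes h _ _ _ _).1 <|
      hv' (fixedPoints _ (isAutotopism_leftDefect h hF x y u))
        fun w hw => (leftDefect_fixes h _ _ _ _).2 (hv w hw)
  have right (y u v : Q) (hx : ∀ x ∈ S, MedialAt x y u v) : ∀ x ∈ H.carrier, MedialAt x y u v :=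
    fun x hx' => (rightDefect_fixes hs _ _ _ _).1 <|
      hx' (fixedPoints _ (isAutotopism_rightDefect hs hF y u v))
        fun w hw => (rightDefect_fixes hs _ _ _ _).2 (hx w hw)
  have cyclic (x y u : Q) (hx : x ∈ H.carrier) (hy : y ∈ H.carrier)
      (hv : ∀ v ∈ H.carrier, MedialAt x y u v) : ∀ v ∈ H.carrier, MedialAt y u x v :=
    fun v hv' => (leftDefect_fixes h _ _ _ _).1 <| leftDefect_cyclic_apply <|
      (leftDefect_fixes h _ _ _ _).2 <| hv _ <| H.ldiv_mem hy (H.mul_mem hx hv')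
  -- Four slots, three generators: two slots agree, and each of the six pairs has its law.
  have generators : ∀ x ∈ S, ∀ y ∈ S, ∀ u ∈ S, ∀ v ∈ S, MedialAt x y u v := by
    have h1 (x u v : Q) : MedialAt x x u v := h x u v
    have h2 (x y v : Q) : MedialAt x y x v := (h x y v).symm
    have h3 (x y v : Q) : MedialAt x y y v := rfl
    have h4 := medialAt_outer hs hF
    have h5 := hs.medialAt_right
    have h6 := hs.medialAt_outer_right
    rintro x (rfl | rfl | rfl) y (rfl | rfl | rfl) u (rfl | rfl | rfl) v (rfl | rfl | rfl) <;>
      first | exact h1 _ _ _ | exact h2 _ _ _ | exact h3 _ _ _ | exact h4 _ _ _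
            | exact h5 _ _ _ | exact h6 _ _ _
  have two (x y u : Q) (hx : x ∈ H.carrier) (hy : y ∈ S) (hu : u ∈ S) :
      ∀ v ∈ H.carrier, MedialAt x y u v :=
    left x y u fun v hv => right y u v (fun x hx => generators x hx y hy u hu v hv) x hx
  -- Rotating the first three slots moves the freed entry from `x` to `u`; the right defect then
  -- frees `x` again.
  have one (x y u : Q) (hx : x ∈ H.carrier) (hy : y ∈ S) (hu : u ∈ H.carrier) :
      ∀ v ∈ H.carrier, MedialAt x y u v :=
    left x y u fun v hv => right y u v
      (fun g hg => cyclic u g y hu (hSH hg) (two u g y hu hg hy) v (hSH hv)) x hx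
  intro x y u v
  refine Subtype.ext (right y u v (fun g hg => ?_) x x.2)
  exact cyclic u g y u.2 (hSH hg) (one u g y u.2 hg y.2) v v.2

theorem IsTrimedial.medialAt (ht : IsTrimedial Q) {a b c x y u v : Q}
    (hx : x ∈ (Subquasigroup.closure {a, b, c}).carrier)
    (hy : y ∈ (Subquasigroup.closure {a, b, c}).carrier)
    (hu : u ∈ (Subquasigroup.closure {a, b, c}).carrier)
    (hv : v ∈ (Subquasigroup.closure {a, b, c}).carrier) : MedialAt x y u v :=
  congrArg Subtype.val (ht a b c ⟨x, hx⟩ ⟨y, hy⟩ ⟨u, hu⟩ ⟨v, hv⟩)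

theorem IsTrimedial.laws (ht : IsTrimedial Q) :
    (IsRightSemimedial Q ∧ IsLeftF Q) ∧ (IsLeftSemimedial Q ∧ IsRightF Q) := by
  have mem (x y z : Q) := subset_closure ({x, y, z} : Set Q)
  have h1 (x y z : Q) := mem x y z (Or.inl rfl)
  have h2 (x y z : Q) := mem x y z (Or.inr (Or.inl rfl))
  have h3 (x y z : Q) := mem x y z (Or.inr (Or.inr rfl))
  refine ⟨⟨fun x y z => ?_, fun x y z => ?_⟩, fun x y z => ?_, fun x y z => ?_⟩
  · exact ht.medialAt (h3 x y z) (h2 x y z) (h1 x y z) (h1 x y z)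
  · have := ht.medialAt (h1 x y z) (Subquasigroup.ldiv_mem _ (h1 x y z) (h1 x y z))
      (h2 x y z) (h3 x y z)
    rwa [MedialAt, mul_ldiv] at this
  · exact ht.medialAt (h1 x y z) (h1 x y z) (h2 x y z) (h3 x y z)
  · have := ht.medialAt (h3 x y z) (h2 x y z)
      (Subquasigroup.rdiv_mem _ (h1 x y z) (h1 x y z)) (h1 x y z)
    rwa [MedialAt, rdiv_mul] at this

/-! ### Duality -/

/-- The opposite quasigroup. -/
@[reducible] def opposite (Q : Type*) [Quasigroup Q] : Quasigroup Qᵐᵒᵖ where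
  toMul := inferInstance
  div x y := .op (ldiv y.unop x.unop)
  ldiv x y := .op (y.unop / x.unop)
  ldiv_mul x y := congrArg MulOpposite.op (mul_rdiv y.unop x.unop)
  mul_ldiv x y := congrArg MulOpposite.op (rdiv_mul y.unop x.unop)
  mul_rdiv x y := congrArg MulOpposite.op (ldiv_mul y.unop x.unop)
  rdiv_mul x y := congrArg MulOpposite.op (mul_ldiv y.unop x.unop)

/-- The subset of `Q` corresponding to a subquasigroup of the opposite quasigroup. -/
def unopSubquasigroup (H : @Subquasigroup Qᵐᵒᵖ (opposite Q)) : Subquasigroup Q :=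
  letI := opposite Q
  { carrier := {x | MulOpposite.op x ∈ H.carrier}
    mul_mem := fun hx hy => H.mul_mem hy hx
    ldiv_mem := fun hx hy => H.rdiv_mem hy hx
    rdiv_mem := fun hx hy => H.ldiv_mem hy hx }

theorem isTrimedial_of_opposite (ht : @IsTrimedial Qᵐᵒᵖ (opposite Q)) : IsTrimedial Q := by
  let := opposite Q
  intro a b c x y u v
  have mem (z : (Subquasigroup.closure ({a, b, c} : Set Q)).carrier) : MulOpposite.op z.1 ∈
      (Subquasigroup.closure ({.op a, .op b, .op c} : Set Qᵐᵒᵖ)).carrier := by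
    intro H hH
    refine z.2 (unopSubquasigroup H) ?_
    rintro w (rfl | rfl | rfl)
    · exact hH (Or.inl rfl)
    · exact hH (Or.inr (Or.inl rfl))
    · exact hH (Or.inr (Or.inr rfl))
  -- Reversing all products sends the medial law at `v, u, y, x` to the one at `x, y, u, v`.
  exact Subtype.ext <| congrArg MulOpposite.unop <|
    ht.medialAt (mem v) (mem u) (mem y) (mem x)

theorem isTrimedial_of_isLeftSemimedial (hs : IsLeftSemimedial Q) (hF : IsRightF Q) :
    IsTrimedial Q := by
  let := opposite Q
  refine isTrimedial_of_opposite (isTrimedial_of_isRightSemimedial (fun x y z => ?_)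
    fun x y z => ?_)
  · exact congrArg MulOpposite.op (hs x.unop y.unop z.unop)
  · exact congrArg MulOpposite.op (hF x.unop y.unop z.unop)

end Quasigroup

theorem theorem1p3 (Q : Type*) [Quasigroup Q] :
    [Quasigroup.IsTrimedial Q,
      Quasigroup.IsRightSemimedial Q ∧ Quasigroup.IsLeftF Q,
      Quasigroup.IsLeftSemimedial Q ∧ Quasigroup.IsRightF Q].TFAE := by
  tfae_have 1 → 2 := fun h => h.laws.1
  tfae_have 1 → 3 := fun h => h.laws.2
  tfae_have 2 → 1 := fun h => Quasigroup.isTrimedial_of_isRightSemimedial h.1 h.2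
  tfae_have 3 → 1 := fun h => Quasigroup.isTrimedial_of_isLeftSemimedial h.1 h.2
  tfae_finish
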